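/- Let $S$ be a Polish space and let $C_0(S)$ be the space of continuous functions $S\to\mathbb R$ that tend to $0$ at infinity, with the uniform norm. Let $D$ be the space of càdlàg functions from $\mathbb R_+$ to $S$ with its product $\sigma$-algebra, let $X=(X_t)_{t\ge0}$ be the canonical process on $D$, and let $\theta_s$ be the time shifts on $D$. Consider a Feller process on $S$, i.e. probability measures $(\mathbf P_x)_{x\in S}$ on $D$ (with expectations $\mathbf E_x$) and a right-continuous filtration $(\mathcal F_t)_{t\ge 0}$ on $D$ to which $X$ is adapted, such that $\mathbf P_x[X_0=x]=1$ for every $x\in S$; such that $x\mapsto \mathbf E_x[f(X_t)]$ belongs to $C_0(S)$ for every $f\in C_0(S)$ and $t\ge0$; and such that the Markov property holds: $\mathbf E_x[Y\circ\theta_s\mid\mathcal F_s]=\mathbf E_{X_s}[Y]$ $\mathbf P_x$-a.s. for every $x\in S$, every $s\ge0$ and every bounded measurable $Y:D\to\mathbb R$. Let $P_tf(x)=\mathbf E_x[f(X_t)]$, let $\mathcal D(L)$ be the set of $f\in C_0(S)$ for which $$Lf=\lim_{t\downarrow0}\frac{P_tf-f}{t}$$ exists in $C_0(S)$, and, when $f$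 and $f^2$ are in $\mathcal D(L)$, let $\Gamma_f=Lf^2-2fLf$. Let $f\in\mathcal D(L)$. Then, for every $x\in S$, the process $$M_f(t)=f(X_t)-f(X_0)-\int_0^t Lf(X_s)\,\mathrm ds$$ is an $(\mathcal F_t)$-martingale under $\mathbf P_x$. If moreover $f^2\in\mathcal D(L)$, then, for every $x\in S$, the predictable quadratic variation of $M_f$ under $\mathbf P_x$ is $$\langle M_f\rangle_t=\int_0^t\Gamma_f(X_s)\,\mathrm ds,$$ that is: $M_f$ is a càdlàg square-integrable martingale, the process $A_t=\int_0^t\Gamma_f(X_s)\,\mathrm ds$ is predictable, $A_0=0$, $A$ has nondecreasing càdlàg paths almost surely, and $M_f^2-A$ is an $(\mathcal F_t)$-martingale under $\mathbf P_x$. -/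

import Mathlib

open MeasureTheory Filter Topology
open scoped NNReal ZeroAtInfty

/-- A càdlàg path: right-continuous with left limits at every time. At `t = 0` the left-limit
clause is void, as the punctured left neighbourhood filter of `0` in `ℝ≥0` is trivial. -/
def IsCadlag {E : Type*} [TopologicalSpace E] (w : ℝ≥0 → E) : Prop :=
  ∀ t : ℝ≥0, ContinuousWithinAt w (Set.Ici t) t ∧ ∃ l : E, Tendsto w (𝓝[<] t) (𝓝 l)

/-- The space `D` of càdlàg functions from `ℝ≥0` to `S`. The coordinate at time `t` of the
canonical process is `ω ↦ ω.1 t`, and `D` carries the product σ-algebra, generated by these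
coordinate maps (the subtype instance). -/
abbrev CadlagPath (S : Type*) [TopologicalSpace S] : Type _ :=
  {w : ℝ≥0 → S // IsCadlag w}

theorem IsCadlag.shift {E : Type*} [TopologicalSpace E] {w : ℝ≥0 → E} (hw : IsCadlag w)
    (s : ℝ≥0) : IsCadlag (fun t => w (s + t)) := by
  intro t
  have hc : Continuous (fun u : ℝ≥0 => s + u) := by fun_prop
  refine ⟨?_, ?_⟩
  · refine ContinuousWithinAt.comp (f := fun u : ℝ≥0 => s + u) (t := Set.Ici (s + t))
      (hw (s + t)).1 hc.continuousWithinAt ?_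
    intro u hu
    exact add_le_add_right hu s
  · obtain ⟨l, hl⟩ := (hw (s + t)).2
    refine ⟨l, hl.comp ?_⟩
    refine tendsto_nhdsWithin_of_tendsto_nhds_of_eventually_within _
      ((hc.tendsto t).mono_left nhdsWithin_le_nhds) ?_
    filter_upwards [self_mem_nhdsWithin] with u hu
    exact add_lt_add_right hu s

/-- The time shift `θ_s` on the path space: `(θ_s ω)(t) = ω(s + t)`. -/
def CadlagPath.shift {S : Type*} [TopologicalSpace S] (s : ℝ≥0) (ω : CadlagPath S) :
    CadlagPath S :=
  ⟨fun t => ω.1 (s + t), ω.2.shift s⟩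

/-- A Feller process with state space `S`, realised on the space of càdlàg paths. -/
structure FellerProcess (S : Type*) [TopologicalSpace S] [MeasurableSpace S] where
  /-- The law `P_x` of the process started at `x`. -/
  law : S → Measure (CadlagPath S)
  isProbabilityMeasure_law : ∀ x, IsProbabilityMeasure (law x)
  /-- The filtration `(F_t)`. -/
  filtration : Filtration ℝ≥0 (Subtype.instMeasurableSpace : MeasurableSpace (CadlagPath S))
  isRightContinuous_filtration : filtration.IsRightContinuous
  /-- The canonical process is adapted to the filtration. -/
  adapted : ∀ t : ℝ≥0, Measurable[filtration t] (fun ω : CadlagPath S => ω.1 t)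
  /-- `P_x[X_0 = x] = 1`. -/
  law_start : ∀ x, ∀ᵐ ω ∂(law x), ω.1 0 = x
  /-- For `f` in `C₀(S)`, the function `x ↦ E_x[f(X_t)]` is in `C₀(S)`. -/
  feller : ∀ (f : C₀(S, ℝ)) (t : ℝ≥0),
    Continuous (fun x => ∫ ω, f (ω.1 t) ∂(law x)) ∧
      Tendsto (fun x => ∫ ω, f (ω.1 t) ∂(law x)) (cocompact S) (𝓝 0)
  /-- The Markov property: `E_x[Y ∘ θ_s | F_s] = E_{X_s}[Y]`, `P_x`-almost surely, for every
  bounded measurable function `Y` on the path space. -/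
  markov : ∀ (x : S) (s : ℝ≥0) (Y : CadlagPath S → ℝ), Measurable Y →
    (∃ C : ℝ, ∀ ω, |Y ω| ≤ C) →
      (law x)[fun ω => Y (CadlagPath.shift s ω) | filtration s]
        =ᵐ[law x] fun ω => ∫ η, Y η ∂(law (ω.1 s))

namespace FellerProcess

variable {S : Type*} [TopologicalSpace S] [MeasurableSpace S]

/-- The semigroup `P_t f (x) = E_x[f(X_t)]` on `C₀(S)`. -/
noncomputable def semigroup (X : FellerProcess S) (t : ℝ≥0) (f : C₀(S, ℝ)) : C₀(S, ℝ) where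
  toFun x := ∫ ω, f (ω.1 t) ∂(X.law x)
  continuous_toFun := (X.feller f t).1
  zero_at_infty' := (X.feller f t).2

/-- The difference quotient `(P_t f - f) / t`. -/
noncomputable def diffQuotient (X : FellerProcess S) (f : C₀(S, ℝ)) (t : ℝ≥0) : C₀(S, ℝ) :=
  (t : ℝ)⁻¹ • (X.semigroup t f - f)

/-- The domain `D(L)`: those `f` in `C₀(S)` for which `(P_t f - f) / t` converges in the uniform
norm to an element of `C₀(S)` as `t ↓ 0`. -/
def domain (X : FellerProcess S) : Set C₀(S, ℝ) :=
  {f | ∃ g : C₀(S, ℝ), Tendsto (X.diffQuotient f) (𝓝[>] 0) (𝓝 g)}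

/-- The infinitesimal generator `L f = lim_{t ↓ 0} (P_t f - f) / t`, meaningful for `f` in the
domain. -/
noncomputable def generator (X : FellerProcess S) (f : C₀(S, ℝ)) : C₀(S, ℝ) :=
  limUnder (𝓝[>] (0 : ℝ≥0)) (X.diffQuotient f)

/-- The carré du champ `Γ_f = L f² - 2 f L f`, meaningful when `f` and `f²` are in the domain. -/
noncomputable def carreDuChamp (X : FellerProcess S) (f : C₀(S, ℝ)) : C₀(S, ℝ) :=
  X.generator (f * f) - (2 : ℝ) • (f * X.generator f)

/-- The process `∫_0^t g(X_s) ds`. -/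
noncomputable def additiveFunctional (g : C₀(S, ℝ)) (t : ℝ≥0) (ω : CadlagPath S) : ℝ :=
  ∫ s in (0 : ℝ)..(t : ℝ), g (ω.1 s.toNNReal)

/-- The process `M_f(t) = f(X_t) - f(X_0) - ∫_0^t L f(X_s) ds`. -/
noncomputable def dynkin (X : FellerProcess S) (f : C₀(S, ℝ)) (t : ℝ≥0)
    (ω : CadlagPath S) : ℝ :=
  f (ω.1 t) - f (ω.1 0) - additiveFunctional (X.generator f) t ω

end FellerProcess

/-- `A` is (a version of) the predictable quadratic variation `⟨M⟩` of the càdlàg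
square-integrable martingale `M`: it is predictable, starts at `0`, has nondecreasing càdlàg paths
almost surely, and `M² - A` is a martingale. -/
structure IsPredictableQuadraticVariation {Ω : Type*} {m : MeasurableSpace Ω}
    (M A : ℝ≥0 → Ω → ℝ) (𝓕 : Filtration ℝ≥0 m) (μ : Measure Ω) : Prop where
  martingale : Martingale M 𝓕 μ
  memLp_two : ∀ t, MemLp (M t) 2 μ
  cadlag : ∀ᵐ ω ∂μ, IsCadlag (fun t => M t ω)
  predictable : IsStronglyPredictable 𝓕 A
  zero : ∀ᵐ ω ∂μ, A 0 ω = 0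
  monotone : ∀ᵐ ω ∂μ, Monotone (fun t => A t ω)
  cadlag_variation : ∀ᵐ ω ∂μ, IsCadlag (fun t => A t ω)
  martingale_sq_sub : Martingale (fun t ω => M t ω ^ 2 - A t ω) 𝓕 μ

/-! Write `M = X.dynkin f`, `g = X.generator f`, `I_t = ∫₀ᵗ g(X_s) ds`, `A_t = ∫₀ᵗ Γ_f(X_s) ds`. All
variables involved are bounded at each fixed time.

Since `M_{s+t} = M_s + M_t ∘ θ_s` (`dynkin_add_shift`), the Markov property reduces the martingale
property of `M` to `E_y[M_t] = 0` for every `y`. This is Dynkin's formula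
`integral_additiveFunctional_generator`, obtained by integrating the right derivative `P_s g` of `s
↦ P_s f`.

The increment of `M² - A` is `(M_t² - A_t) ∘ θ_s + 2 M_s (M_t ∘ θ_s)`. The cross term is
conditionally centred, so again only `E_y[M_t² - A_t] = 0` is needed
(`integral_dynkin_sq_sub_eq_zero`). Squaring `f(X_t) = f(X_0) + M_t + I_t` expresses `M_t² - A_t`
through the Dynkin martingale of `f²`, the centred variable `f(X_0) M_t`, and `I_t M_t - ∫₀ᵗ g(X_s)
M_s ds`; the last is centred because `E[g(X_s) M_t] = E[g(X_s) M_s]` for `s ≤ t`.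

Finally `A` is continuous and adapted, hence predictable, and nondecreasing because `Γ_f ≥ 0`
(`carreDuChamp_nonneg`). -/

/-! ### Measurability and predictability from path regularity. -/

/-- A process indexed by `ℝ` with right-continuous paths is jointly measurable. -/
theorem measurable_uncurry_of_continuousWithinAt_Ici {Ω : Type*} {m : MeasurableSpace Ω}
    {u : ℝ → Ω → ℝ} (hu : ∀ s, Measurable (u s))
    (hc : ∀ ω s, ContinuousWithinAt (fun s => u s ω) (Set.Ici s) s) :
    Measurable (Function.uncurry u) := by
  have hpos : ∀ n : ℕ, (0 : ℝ) < n + 1 := fun n => by positivity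
  -- Time is rounded up to a grid point strictly to the right, within `1 / (n + 1)`; only countably
  -- many values occur, and right-continuity gives the limit.
  have hmeas : ∀ n : ℕ, Measurable
      (fun p : ℝ × Ω => u ((⌊((n : ℝ) + 1) * p.1⌋ + 1 : ℝ) / (n + 1)) p.2) := by
    intro n
    have h1 : Measurable (fun q : ℤ × Ω => u ((q.1 + 1 : ℝ) / (n + 1)) q.2) :=
      measurable_from_prod_countable_right fun k => hu ((k + 1 : ℝ) / (n + 1))
    exact h1.comp ((Int.measurable_floor.comp (measurable_fst.const_mul _)).prodMk measurable_snd)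
  refine measurable_of_tendsto_metrizable hmeas (tendsto_pi_nhds.2 fun p => ?_)
  refine (hc p.2 p.1).tendsto.comp (tendsto_nhdsWithin_of_tendsto_nhds_of_eventually_within _ ?_
    (Eventually.of_forall fun n => ?_))
  · have hlim : Tendsto (fun n : ℕ => p.1 + 1 / ((n : ℝ) + 1)) atTop (𝓝 p.1) := by
      simpa using tendsto_one_div_add_atTop_nhds_zero_nat.const_add p.1
    refine tendsto_of_tendsto_of_tendsto_of_le_of_le tendsto_const_nhds hlim ?_ ?_
    · intro n
      rw [le_div_iff₀ (hpos n)]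
      linarith [Int.lt_floor_add_one (((n : ℝ) + 1) * p.1)]
    · intro n
      dsimp only
      rw [div_le_iff₀ (hpos n), add_mul p.1, div_mul_cancel₀ _ (hpos n).ne', mul_comm p.1]
      linarith [Int.floor_le (((n : ℝ) + 1) * p.1)]
  · rw [Set.mem_Ici, le_div_iff₀ (hpos n)]
    linarith [Int.lt_floor_add_one (((n : ℝ) + 1) * p.1)]

/-- An adapted process with continuous paths is predictable. -/
theorem isStronglyPredictable_of_continuous {Ω : Type*} {m : MeasurableSpace Ω}
    {𝓕 : Filtration ℝ≥0 m} {A : ℝ≥0 → Ω → ℝ} (hA : ∀ t, Measurable[𝓕 t] (A t))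
    (hc : ∀ ω, Continuous fun t => A t ω) : IsStronglyPredictable 𝓕 A := by
  let : MeasurableSpace (ℝ≥0 × Ω) := 𝓕.predictable
  have hpos : ∀ n : ℕ, (0 : ℝ≥0) < n + 1 := fun n => by positivity
  refine Measurable.stronglyMeasurable ?_
  -- The last grid point strictly before `t`, constant on left-open right-closed cells as
  -- predictable rectangles require. Truncated subtraction gives `r n 0 = 0`, the separate `{⊥}`
  -- piece below.
  let r : ℕ → ℝ≥0 → ℝ≥0 := fun n t => ((⌈((n : ℝ≥0) + 1) * t⌉₊ - 1 : ℕ) : ℝ≥0) / (n + 1)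
  have hmeas : ∀ n : ℕ, Measurable (fun p : ℝ≥0 × Ω => A (r n p.1) p.2) := by
    intro n B hB
    have heq : (fun p : ℝ≥0 × Ω => A (r n p.1) p.2) ⁻¹' B =
        ({⊥} ×ˢ (A 0 ⁻¹' B)) ∪ ⋃ k : ℕ, Set.Ioc ((k : ℝ≥0) / (n + 1)) (((k : ℝ≥0) + 1) / (n + 1)) ×ˢ
          (A ((k : ℝ≥0) / (n + 1)) ⁻¹' B) := by
      have key : ∀ (t : ℝ≥0) (k : ℕ), t ∈ Set.Ioc ((k : ℝ≥0) / (n + 1)) (((k : ℝ≥0) + 1) / (n + 1)) →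
          r n t = (k : ℝ≥0) / (n + 1) := by
        intro t k hk
        have : ⌈((n : ℝ≥0) + 1) * t⌉₊ = k + 1 := by
          rw [Nat.ceil_eq_iff (by omega)]
          have h1 := (div_lt_iff₀ (hpos n)).1 hk.1
          have h2 := (le_div_iff₀ (hpos n)).1 hk.2
          rw [mul_comm t] at h1 h2
          exact ⟨by simpa using h1, by simpa using h2⟩
        simp [r, this]
      ext ⟨t, ω⟩
      simp only [Set.mem_preimage, Set.mem_union, Set.mem_prod, Set.mem_singleton_iff,
        Set.mem_iUnion]
      constructor
      · intro h
        rcases eq_or_ne t 0 with rfl | ht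
        · left
          exact ⟨rfl, by simpa [r] using h⟩
        · right
          have hx : 0 < ((n : ℝ≥0) + 1) * t := mul_pos (hpos n) (pos_iff_ne_zero.2 ht)
          obtain ⟨k, hk⟩ := Nat.exists_eq_succ_of_ne_zero (Nat.ceil_pos.2 hx).ne'
          have hk' := hk
          rw [Nat.succ_eq_add_one, Nat.ceil_eq_iff (by omega)] at hk'
          have hkt : t ∈ Set.Ioc ((k : ℝ≥0) / (n + 1)) (((k : ℝ≥0) + 1) / (n + 1)) := by
            rw [Set.mem_Ioc, div_lt_iff₀ (hpos n), le_div_iff₀ (hpos n), mul_comm t]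
            exact ⟨by simpa using hk'.1, by simpa using hk'.2⟩
          exact ⟨k, hkt, by rwa [key t k hkt] at h⟩
      · rintro (⟨rfl, h⟩ | ⟨k, hk, h⟩)
        · simpa [r] using h
        · rwa [key t k hk]
    rw [heq]
    exact (measurableSet_predictable_singleton_bot_prod (hA 0 hB)).union
      (MeasurableSet.iUnion fun k => measurableSet_predictable_Ioc_prod _ _ (hA _ hB))
  refine measurable_of_tendsto_metrizable hmeas (tendsto_pi_nhds.2 fun p => ?_)
  refine ((hc p.2).tendsto p.1).comp ?_
  have hlow : ∀ n : ℕ, p.1 - 1 / ((n : ℝ≥0) + 1) ≤ r n p.1 := by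
    intro n
    rw [tsub_le_iff_right, ← add_div, le_div_iff₀ (hpos n), mul_comm]
    refine (Nat.le_ceil _).trans ?_
    exact_mod_cast (by omega : ⌈((n : ℝ≥0) + 1) * p.1⌉₊ ≤ ⌈((n : ℝ≥0) + 1) * p.1⌉₊ - 1 + 1)
  have hup : ∀ n : ℕ, r n p.1 ≤ p.1 := by
    intro n
    rw [div_le_iff₀ (hpos n), mul_comm p.1]
    rcases Nat.eq_zero_or_pos ⌈((n : ℝ≥0) + 1) * p.1⌉₊ with h | h
    · rw [h]
      simp
    · exact (Nat.lt_ceil.1 (Nat.sub_lt h one_pos)).le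
  have hlim : Tendsto (fun n : ℕ => p.1 - 1 / ((n : ℝ≥0) + 1)) atTop (𝓝 p.1) := by
    have h0 : Tendsto (fun n : ℕ => 1 / ((n : ℝ≥0) + 1)) atTop (𝓝 0) :=
      tendsto_one_div_add_atTop_nhds_zero_nat
    simpa using (tendsto_const_nhds (x := p.1)).sub h0
  exact tendsto_of_tendsto_of_tendsto_of_le_of_le hlim tendsto_const_nhds hlow hup

/-! ### Pathwise calculus for `∫₀ᵗ g(X_s) ds`. -/

theorem ZeroAtInftyContinuousMap.abs_apply_le_norm {S : Type*} [TopologicalSpace S] (f : C₀(S, ℝ))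
    (x : S) : |f x| ≤ ‖f‖ :=
  f.toBCF.norm_coe_le_norm x

namespace FellerProcess

section Path

variable {S : Type*} [TopologicalSpace S]

theorem continuousWithinAt_path (g : C₀(S, ℝ)) (ω : CadlagPath S) (s : ℝ) :
    ContinuousWithinAt (fun u : ℝ => g (ω.1 u.toNNReal)) (Set.Ici s) s :=
  (map_continuous g).continuousAt.comp_continuousWithinAt
    ((ω.2 s.toNNReal).1.comp (f := Real.toNNReal) continuous_real_toNNReal.continuousWithinAt
      fun _ hu => Real.toNNReal_le_toNNReal hu)

theorem measurable_path (g : C₀(S, ℝ)) (ω : CadlagPath S) :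
    Measurable (fun u : ℝ => g (ω.1 u.toNNReal)) := by
  -- A single path is a process over a one-point space.
  have := measurable_uncurry_of_continuousWithinAt_Ici (Ω := Unit) (m := ⊤)
    (u := fun s _ => g (ω.1 s.toNNReal)) (fun _ => measurable_const)
    fun _ => continuousWithinAt_path g ω
  exact this.comp (measurable_id.prodMk (measurable_const (a := ())))

theorem intervalIntegrable_path (g : C₀(S, ℝ)) (ω : CadlagPath S) (a b : ℝ) :
    IntervalIntegrable (fun u : ℝ => g (ω.1 u.toNNReal)) volume a b := by
  rw [intervalIntegrable_iff]
  refine IntegrableOn.of_bound measure_Ioc_lt_top (measurable_path g ω).aestronglyMeasurable ‖g‖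
    (Eventually.of_forall fun u => g.abs_apply_le_norm _)

theorem abs_additiveFunctional_le (g : C₀(S, ℝ)) (t : ℝ≥0) (ω : CadlagPath S) :
    |additiveFunctional g t ω| ≤ ‖g‖ * t := by
  have := intervalIntegral.norm_integral_le_of_norm_le_const (a := 0) (b := (t : ℝ))
    (f := fun s => g (ω.1 s.toNNReal)) (C := ‖g‖) fun u _ => g.abs_apply_le_norm _
  simpa [additiveFunctional] using this

theorem continuous_integral_path (g : C₀(S, ℝ)) (ω : CadlagPath S) :
    Continuous (fun t : ℝ => ∫ s in (0 : ℝ)..t, g (ω.1 s.toNNReal)) :=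
  intervalIntegral.continuous_primitive (intervalIntegrable_path g ω) 0

theorem continuous_additiveFunctional (g : C₀(S, ℝ)) (ω : CadlagPath S) :
    Continuous (fun t => additiveFunctional g t ω) :=
  (continuous_integral_path g ω).comp NNReal.continuous_coe

theorem additiveFunctional_zero (g : C₀(S, ℝ)) (ω : CadlagPath S) :
    additiveFunctional g 0 ω = 0 := by
  simp [additiveFunctional]

theorem additiveFunctional_sub (g h : C₀(S, ℝ)) (t : ℝ≥0) (ω : CadlagPath S) :
    additiveFunctional (g - h) t ω = additiveFunctional g t ω - additiveFunctional h t ω :=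
  intervalIntegral.integral_sub (intervalIntegrable_path g ω _ _) (intervalIntegrable_path h ω _ _)

theorem additiveFunctional_smul (c : ℝ) (g : C₀(S, ℝ)) (t : ℝ≥0) (ω : CadlagPath S) :
    additiveFunctional (c • g) t ω = c * additiveFunctional g t ω :=
  intervalIntegral.integral_const_mul c _

theorem additiveFunctional_add_shift (g : C₀(S, ℝ)) (s t : ℝ≥0) (ω : CadlagPath S) :
    additiveFunctional g (s + t) ω =
      additiveFunctional g s ω + additiveFunctional g t (CadlagPath.shift s ω) := by
  have h : additiveFunctional g t (CadlagPath.shift s ω) =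
      ∫ u in (s : ℝ)..(s + t : ℝ≥0), g (ω.1 u.toNNReal) := by
    have h1 := intervalIntegral.integral_comp_add_left (a := 0) (b := (t : ℝ))
      (fun u => g (ω.1 u.toNNReal)) (s : ℝ)
    rw [add_zero] at h1
    rw [NNReal.coe_add, ← h1]
    refine intervalIntegral.integral_congr fun u hu => ?_
    rw [Set.uIcc_of_le t.coe_nonneg] at hu
    simp only [CadlagPath.shift, Real.toNNReal_add s.coe_nonneg hu.1, Real.toNNReal_coe]
  rw [h, additiveFunctional, additiveFunctional, intervalIntegral.integral_add_adjacent_intervals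
    (intervalIntegrable_path g ω _ _) (intervalIntegrable_path g ω _ _)]

theorem additiveFunctional_mono_of_nonneg {g : C₀(S, ℝ)} (hg : ∀ x, 0 ≤ g x) (ω : CadlagPath S) :
    Monotone (fun t => additiveFunctional g t ω) := by
  intro s t hst
  obtain ⟨r, rfl⟩ := exists_add_of_le hst
  dsimp only
  rw [additiveFunctional_add_shift]
  exact le_add_of_nonneg_right (intervalIntegral.integral_nonneg r.2 fun u _ => hg _)

/-- Integration by parts for `∫₀ᵗ g(X_s) ds`. -/
theorem integral_additiveFunctional_mul (g : C₀(S, ℝ)) (t : ℝ≥0) (ω : CadlagPath S) :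
    ∫ s in (0 : ℝ)..(t : ℝ), additiveFunctional g s.toNNReal ω * g (ω.1 s.toNNReal) =
      additiveFunctional g t ω ^ 2 / 2 := by
  let I : ℝ → ℝ := fun t => ∫ s in (0 : ℝ)..t, g (ω.1 s.toNNReal)
  have hI : Continuous I := continuous_integral_path g ω
  -- The integrand is only right-continuous, so the primitive is differentiated from the right only.
  have hd : ∀ s, HasDerivWithinAt I (g (ω.1 s.toNNReal)) (Set.Ioi s) s := fun s =>
    (intervalIntegral.integral_hasDerivWithinAt_right (intervalIntegrable_path g ω 0 s)
      (measurable_path g ω).stronglyMeasurable.stronglyMeasurableAtFilter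
      ((continuousWithinAt_path g ω s).mono Set.Ioi_subset_Ici_self) : HasDerivWithinAt I _
        (Set.Ici s) s).mono Set.Ioi_subset_Ici_self
  have h := intervalIntegral.integral_eq_sub_of_hasDeriv_right (a := 0) (b := (t : ℝ))
    (f := fun s => I s ^ 2 / 2) (f' := fun s => I s * g (ω.1 s.toNNReal))
    (by fun_prop) (fun s _ => by
      refine (((hd s).fun_pow 2).div_const 2).congr_deriv ?_
      simp
      ring)
    ((intervalIntegrable_path g ω _ _).continuousOn_mul hI.continuousOn)
  have h0 : I 0 = 0 := intervalIntegral.integral_same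
  rw [h0] at h
  have ht : I t = additiveFunctional g t ω := rfl
  rw [ht] at h
  rw [zero_pow two_ne_zero, zero_div, sub_zero] at h
  rw [← h]
  refine intervalIntegral.integral_congr fun u hu => ?_
  rw [Set.uIcc_of_le t.coe_nonneg] at hu
  simp only [additiveFunctional, Real.coe_toNNReal u hu.1, I]

theorem isCadlag_comp (f : C₀(S, ℝ)) (ω : CadlagPath S) : IsCadlag (fun t => f (ω.1 t)) := by
  intro t
  obtain ⟨h, l, hl⟩ := ω.2 t
  exact ⟨(map_continuous f).continuousAt.comp_continuousWithinAt h, f l,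
    ((map_continuous f).tendsto l).comp hl⟩

end Path

end FellerProcess

/-! ### Càdlàg functions and Fubini for time integrals. -/

theorem Continuous.isCadlag {E : Type*} [TopologicalSpace E] {w : ℝ≥0 → E} (hw : Continuous w) :
    IsCadlag w := fun t =>
  ⟨hw.continuousWithinAt, w t, (hw.tendsto t).mono_left nhdsWithin_le_nhds⟩

theorem IsCadlag.sub {E : Type*} [AddGroup E] [TopologicalSpace E] [IsTopologicalAddGroup E]
    {v w : ℝ≥0 → E} (hv : IsCadlag v) (hw : IsCadlag w) :
    IsCadlag (fun t => v t - w t) := by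
  intro t
  obtain ⟨h, l, hl⟩ := hv t
  obtain ⟨h', l', hl'⟩ := hw t
  exact ⟨h.sub h', l - l', hl.sub hl'⟩

theorem Measurable.intervalIntegral_of_uncurry {Ω : Type*} {m : MeasurableSpace Ω} {u : ℝ → Ω → ℝ}
    (hu : Measurable (Function.uncurry u)) {a b : ℝ} (hab : a ≤ b) :
    Measurable (fun ω => ∫ s in a..b, u s ω) := by
  simp only [intervalIntegral.integral_of_le hab]
  exact (hu.comp measurable_swap).stronglyMeasurable.integral_prod_right'.measurable

/-- The bound is asked on the time interval only, because the bound available for `dynkin` grows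
with time. -/
theorem MeasureTheory.integral_intervalIntegral_swap_of_bound {Ω : Type*} {m : MeasurableSpace Ω}
    {μ : Measure Ω} [IsFiniteMeasure μ] {u : ℝ → Ω → ℝ} (hu : Measurable (Function.uncurry u))
    {a b C : ℝ} (hC : ∀ s ∈ Set.uIoc a b, ∀ ω, |u s ω| ≤ C) :
    ∫ ω, (∫ s in a..b, u s ω) ∂μ = ∫ s in a..b, (∫ ω, u s ω ∂μ) := by
  have : IsFiniteMeasure (volume.restrict (Set.uIoc a b)) := ⟨by simp [Set.uIoc]⟩
  refine (intervalIntegral_integral_swap (Integrable.of_bound hu.aestronglyMeasurable C ?_)).symm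
  have h := Measure.prod_restrict (μ := volume) (ν := μ) (Set.uIoc a b) Set.univ
  rw [Measure.restrict_univ] at h
  rw [h]
  exact ae_restrict_of_forall_mem (measurableSet_uIoc.prod .univ) fun p hp => hC _ hp.1 _

/-! ### The semigroup, its generator and Dynkin's formula. -/

namespace FellerProcess

variable {S : Type*} [TopologicalSpace S] [MeasurableSpace S]

instance (X : FellerProcess S) (x : S) : IsProbabilityMeasure (X.law x) :=
  X.isProbabilityMeasure_law x

theorem integral_eval_zero (X : FellerProcess S) (g : C₀(S, ℝ)) (x : S) :
    ∫ ω, g (ω.1 0) ∂(X.law x) = g x := by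
  have : (fun ω : CadlagPath S => g (ω.1 0)) =ᵐ[X.law x] fun _ => g x := by
    filter_upwards [X.law_start x] with ω hω
    rw [hω]
  rw [integral_congr_ae this]
  simp

theorem semigroup_apply (X : FellerProcess S) (t : ℝ≥0) (f : C₀(S, ℝ)) (x : S) :
    X.semigroup t f x = ∫ ω, f (ω.1 t) ∂(X.law x) := rfl

theorem abs_semigroup_apply_le (X : FellerProcess S) (t : ℝ≥0) (f : C₀(S, ℝ)) (x : S) : |X.semigroup t f x| ≤ ‖f‖ := by
  have := norm_integral_le_of_norm_le_const (μ := X.law x) (f := fun ω => f (ω.1 t)) (C := ‖f‖)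
    (Eventually.of_forall fun _ => f.abs_apply_le_norm _)
  simpa [semigroup_apply] using this

theorem semigroup_smul (X : FellerProcess S) (t : ℝ≥0) (c : ℝ) (f : C₀(S, ℝ)) :
    X.semigroup t (c • f) = c • X.semigroup t f := by
  ext x
  exact integral_const_mul c _

theorem semigroup_zero (X : FellerProcess S) (f : C₀(S, ℝ)) : X.semigroup 0 f = f := by
  ext x
  exact X.integral_eval_zero f x

theorem tendsto_diffQuotient (X : FellerProcess S) {f : C₀(S, ℝ)} (hf : f ∈ X.domain) :
    Tendsto (X.diffQuotient f) (𝓝[>] 0) (𝓝 (X.generator f)) :=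
  tendsto_nhds_limUnder hf

theorem semigroup_eq_diffQuotient (X : FellerProcess S) (f : C₀(S, ℝ)) {t : ℝ≥0} (ht : t ≠ 0) :
    X.semigroup t f - f = (t : ℝ) • X.diffQuotient f t := by
  rw [diffQuotient, smul_smul, mul_inv_cancel₀ (by simpa using ht), one_smul]

theorem measurable_shift (s : ℝ≥0) : Measurable (CadlagPath.shift (S := S) s) :=
  Measurable.subtype_mk (f := fun (ω : CadlagPath S) t => ω.1 (s + t))
    (measurable_pi_lambda _ fun t => (measurable_pi_apply (s + t)).comp measurable_subtype_coe)

/-- On the domain, `P_t f - f` is `t` times a convergent quotient, so strong continuity at `0` comes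
for free. -/
theorem tendsto_norm_semigroup_sub (X : FellerProcess S) {f : C₀(S, ℝ)} (hf : f ∈ X.domain) :
    Tendsto (fun t => ‖X.semigroup t f - f‖) (𝓝 0) (𝓝 0) := by
  have h : Tendsto (fun t => ‖X.semigroup t f - f‖) (𝓝[>] 0) (𝓝 0) := by
    have h1 : Tendsto (fun t : ℝ≥0 => (t : ℝ)) (𝓝[>] 0) (𝓝 0) :=
      (NNReal.continuous_coe.tendsto 0).mono_left nhdsWithin_le_nhds
    have h2 := (h1.smul (X.tendsto_diffQuotient hf)).norm
    rw [zero_smul, norm_zero] at h2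
    refine h2.congr' ?_
    filter_upwards [self_mem_nhdsWithin] with t ht
    rw [X.semigroup_eq_diffQuotient f (ne_of_gt ht)]
  have hu : (𝓝 (0 : ℝ≥0)) = 𝓝[>] 0 ⊔ pure 0 := by
    rw [← nhdsWithin_univ, ← Set.Ici_bot, bot_eq_zero, ← Set.Ioi_insert, nhdsWithin_insert,
      sup_comm]
  rw [hu]
  refine h.sup ?_
  rw [tendsto_pure_left]
  intro s hs
  rw [X.semigroup_zero, sub_self, norm_zero]
  exact mem_of_mem_nhds hs

variable [OpensMeasurableSpace S]

theorem measurable_eval (g : C₀(S, ℝ)) (t : ℝ≥0) :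
    Measurable (fun ω : CadlagPath S => g (ω.1 t)) :=
  (map_continuous g).measurable.comp ((measurable_pi_apply t).comp measurable_subtype_coe)

theorem measurable_uncurry_path (g : C₀(S, ℝ)) :
    Measurable (Function.uncurry fun (s : ℝ) (ω : CadlagPath S) => g (ω.1 s.toNNReal)) :=
  measurable_uncurry_of_continuousWithinAt_Ici (fun _ => measurable_eval g _)
    (continuousWithinAt_path g)

theorem measurable_additiveFunctional (g : C₀(S, ℝ)) (t : ℝ≥0) :
    Measurable (fun ω : CadlagPath S => additiveFunctional g t ω) :=
  (measurable_uncurry_path g).intervalIntegral_of_uncurry t.coe_nonneg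

variable (X : FellerProcess S)

theorem measurable_eval_filtration (g : C₀(S, ℝ)) (t : ℝ≥0) :
    Measurable[X.filtration t] (fun ω : CadlagPath S => g (ω.1 t)) :=
  (map_continuous g).measurable.comp (X.adapted t)

theorem measurable_additiveFunctional_filtration (g : C₀(S, ℝ)) (t : ℝ≥0) :
    Measurable[X.filtration t] (fun ω : CadlagPath S => additiveFunctional g t ω) := by
  -- Capping time at `t` makes every section `𝓕_t`-measurable without changing the integral over
  -- `[0, t]`.
  have h := measurable_uncurry_of_continuousWithinAt_Ici (m := X.filtration t)
    (u := fun (s : ℝ) (ω : CadlagPath S) => g (ω.1 (min s t).toNNReal))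
    (fun s => by
      have hs : (min s t).toNNReal ≤ t := Real.toNNReal_le_iff_le_coe.2 (min_le_right _ _)
      exact (X.measurable_eval_filtration g _).mono (X.filtration.mono hs) le_rfl)
    (fun ω s => (continuousWithinAt_path g ω (min s t)).comp (f := fun s : ℝ => min s t)
      (by fun_prop) fun u hu => Set.mem_Ici.2 (min_le_min_right (t : ℝ) hu))
  have h' := Measurable.intervalIntegral_of_uncurry (m := X.filtration t) h t.coe_nonneg
  convert h' using 2 with ω
  refine intervalIntegral.integral_congr fun u hu => ?_
  rw [Set.uIcc_of_le t.coe_nonneg] at hu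
  simp only [min_eq_left hu.2]

theorem integrable_eval (g : C₀(S, ℝ)) (t : ℝ≥0) (x : S) :
    Integrable (fun ω : CadlagPath S => g (ω.1 t)) (X.law x) :=
  Integrable.of_bound (measurable_eval g t).aestronglyMeasurable ‖g‖
    (Eventually.of_forall fun _ => g.abs_apply_le_norm _)

theorem integrable_additiveFunctional (g : C₀(S, ℝ)) (t : ℝ≥0) (x : S) :
    Integrable (fun ω : CadlagPath S => additiveFunctional g t ω) (X.law x) :=
  Integrable.of_bound (measurable_additiveFunctional g t).aestronglyMeasurable (‖g‖ * t)
    (Eventually.of_forall fun _ => abs_additiveFunctional_le _ _ _)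

theorem integral_additiveFunctional (g : C₀(S, ℝ)) (t : ℝ≥0) (x : S) :
    ∫ ω, additiveFunctional g t ω ∂(X.law x) =
      ∫ s in (0 : ℝ)..(t : ℝ), X.semigroup s.toNNReal g x :=
  integral_intervalIntegral_swap_of_bound (measurable_uncurry_path g)
    fun _ _ _ => g.abs_apply_le_norm _

theorem semigroup_sub (t : ℝ≥0) (f g : C₀(S, ℝ)) :
    X.semigroup t (f - g) = X.semigroup t f - X.semigroup t g := by
  ext x
  exact integral_sub (X.integrable_eval f t x) (X.integrable_eval g t x)

/-- Expectation of the Markov property applied to `Y = f(X_t)`. -/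
theorem semigroup_add (s t : ℝ≥0) (f : C₀(S, ℝ)) :
    X.semigroup (s + t) f = X.semigroup s (X.semigroup t f) := by
  ext x
  have h := X.markov x s (fun ω => f (ω.1 t)) (measurable_eval f t)
    ⟨‖f‖, fun _ => f.abs_apply_le_norm _⟩
  rw [semigroup_apply, semigroup_apply, ← integral_condExp (X.filtration.le s)]
  exact integral_congr_ae h

/-- Contractivity gives `|P_{s+r} f - P_s f| ≤ ‖P_r f - f‖`, uniformly in `s`; this yields left as
well as right continuity. -/
theorem continuous_semigroup_apply {f : C₀(S, ℝ)} (hf : f ∈ X.domain) (x : S) :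
    Continuous (fun t => X.semigroup t f x) := by
  have key : ∀ s r : ℝ≥0, |X.semigroup (s + r) f x - X.semigroup s f x| ≤
      ‖X.semigroup r f - f‖ := by
    intro s r
    rw [semigroup_add]
    have := X.abs_semigroup_apply_le s (X.semigroup r f - f) x
    rwa [semigroup_sub] at this
  have key' : ∀ s t : ℝ≥0, dist (X.semigroup s f x) (X.semigroup t f x) ≤
      ‖X.semigroup (nndist s t) f - f‖ := by
    intro s t
    wlog hst : s ≤ t generalizing s t
    · rw [dist_comm, nndist_comm]
      exact this t s (le_of_not_ge hst)
    obtain ⟨r, rfl⟩ := exists_add_of_le hst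
    have hr : nndist s (s + r) = r := by
      ext
      simp [NNReal.dist_eq]
    rw [hr, dist_comm, Real.dist_eq]
    exact key s r
  refine continuous_iff_continuousAt.2 fun t => tendsto_iff_dist_tendsto_zero.2 ?_
  refine squeeze_zero (fun _ => dist_nonneg) (fun s => key' s t) ?_
  refine (X.tendsto_norm_semigroup_sub hf).comp ?_
  have : Continuous fun s : ℝ≥0 => nndist s t := by fun_prop
  simpa using this.tendsto t

/-- The slope from `t` is `P_t` applied to a difference quotient at `0`, and `P_t` is a contraction.
With continuity, a right derivative suffices for the fundamental theorem of calculus. -/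
theorem hasDerivWithinAt_semigroup {f : C₀(S, ℝ)} (hf : f ∈ X.domain) (x : S) {t : ℝ}
    (ht : 0 ≤ t) :
    HasDerivWithinAt (fun s : ℝ => X.semigroup s.toNNReal f x)
      (X.semigroup t.toNNReal (X.generator f) x) (Set.Ioi t) t := by
  rw [hasDerivWithinAt_iff_tendsto_slope' (by simp)]
  have hlim : Tendsto (fun s : ℝ => (s - t).toNNReal) (𝓝[>] t) (𝓝[>] 0) := by
    refine tendsto_nhdsWithin_of_tendsto_nhds_of_eventually_within _ ?_ ?_
    · have : Continuous fun s : ℝ => (s - t).toNNReal := by fun_prop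
      simpa using (this.tendsto t).mono_left nhdsWithin_le_nhds
    · filter_upwards [self_mem_nhdsWithin] with s hs
      exact Real.toNNReal_pos.2 (sub_pos.2 hs)
  have hq := (tendsto_iff_norm_sub_tendsto_zero.1 (X.tendsto_diffQuotient hf)).comp hlim
  rw [tendsto_iff_dist_tendsto_zero]
  refine squeeze_zero' (Eventually.of_forall fun _ => dist_nonneg) ?_ hq
  filter_upwards [self_mem_nhdsWithin] with s hs
  have hs0 : 0 < s - t := sub_pos.2 hs
  have hst : s.toNNReal = t.toNNReal + (s - t).toNNReal := by
    rw [← Real.toNNReal_add ht hs0.le, add_sub_cancel]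
  have : slope (fun s : ℝ => X.semigroup s.toNNReal f x) t s =
      X.semigroup t.toNNReal (X.diffQuotient f (s - t).toNNReal) x := by
    rw [diffQuotient, semigroup_smul, semigroup_sub, ← semigroup_add, ← hst, slope_def_field,
      Real.coe_toNNReal _ hs0.le, div_eq_inv_mul]
    rfl
  rw [this, Real.dist_eq]
  have h := X.abs_semigroup_apply_le t.toNNReal
    (X.diffQuotient f (s - t).toNNReal - X.generator f) x
  rwa [semigroup_sub] at h

theorem measurable_semigroup_apply (g : C₀(S, ℝ)) (x : S) :
    Measurable (fun s : ℝ => X.semigroup s.toNNReal g x) :=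
  (measurable_uncurry_path g).stronglyMeasurable.integral_prod_right'.measurable

/-- Dynkin's formula. -/
theorem integral_additiveFunctional_generator {f : C₀(S, ℝ)} (hf : f ∈ X.domain) (t : ℝ≥0) (x : S) :
    ∫ ω, additiveFunctional (X.generator f) t ω ∂(X.law x) = X.semigroup t f x - f x := by
  rw [integral_additiveFunctional]
  have h := intervalIntegral.integral_eq_sub_of_hasDeriv_right_of_le t.coe_nonneg
    (((X.continuous_semigroup_apply hf x).comp continuous_real_toNNReal).continuousOn)
    (fun s hs => X.hasDerivWithinAt_semigroup hf x hs.1.le)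
    (by
      rw [intervalIntegrable_iff]
      exact IntegrableOn.of_bound measure_Ioc_lt_top
        (X.measurable_semigroup_apply _ x).aestronglyMeasurable ‖X.generator f‖
        (Eventually.of_forall fun s => X.abs_semigroup_apply_le _ _ _))
  rw [h]
  simp [semigroup_zero]

end FellerProcess

/-! ### Bounded variables and martingale criteria. -/

/-- A bounded measurable real function. -/
def IsBoundedMeasurable {Ω : Type*} (m : MeasurableSpace Ω) (u : Ω → ℝ) : Prop :=
  Measurable[m] u ∧ ∃ C : ℝ, ∀ ω, |u ω| ≤ C

namespace IsBoundedMeasurable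

variable {Ω : Type*} {m' m : MeasurableSpace Ω} {u v : Ω → ℝ}

theorem const (c : ℝ) : IsBoundedMeasurable m (fun _ => c) :=
  ⟨measurable_const, |c|, fun _ => le_rfl⟩

theorem sub (hu : IsBoundedMeasurable m u) (hv : IsBoundedMeasurable m v) :
    IsBoundedMeasurable m (fun ω => u ω - v ω) := by
  obtain ⟨hu, C, hC⟩ := hu
  obtain ⟨hv, D, hD⟩ := hv
  exact ⟨hu.sub hv, C + D, fun ω => (abs_sub _ _).trans (add_le_add (hC ω) (hD ω))⟩

theorem mul (hu : IsBoundedMeasurable m u) (hv : IsBoundedMeasurable m v) :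
    IsBoundedMeasurable m (fun ω => u ω * v ω) := by
  obtain ⟨hu, C, hC⟩ := hu
  obtain ⟨hv, D, hD⟩ := hv
  refine ⟨hu.mul hv, C * D, fun ω => ?_⟩
  rw [abs_mul]
  exact mul_le_mul (hC ω) (hD ω) (abs_nonneg _) ((abs_nonneg _).trans (hC ω))

theorem mono (hm : m ≤ m') (hu : IsBoundedMeasurable m u) : IsBoundedMeasurable m' u :=
  ⟨hu.1.mono hm le_rfl, hu.2⟩

theorem memLp (hu : IsBoundedMeasurable m u) (p : ENNReal) (μ : Measure Ω) [IsFiniteMeasure μ] :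
    MemLp u p μ := by
  obtain ⟨hu, C, hC⟩ := hu
  exact MemLp.of_bound hu.aestronglyMeasurable C (Eventually.of_forall hC)

theorem integrable (hu : IsBoundedMeasurable m u) (μ : Measure Ω) [IsFiniteMeasure μ] :
    Integrable u μ :=
  (hu.memLp 1 μ).integrable le_rfl

/-- Bounded measurable factors are pulled out of a vanishing conditional expectation. -/
theorem condExp_mul_eq_zero {μ : Measure Ω} [IsFiniteMeasure μ] (hm : m' ≤ m)
    (hu : IsBoundedMeasurable m' u) (hv : Integrable v μ) (h : μ[v | m'] =ᵐ[μ] 0) :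
    μ[fun ω => u ω * v ω | m'] =ᵐ[μ] 0 := by
  obtain ⟨hu, C, hC⟩ := hu
  filter_upwards [condExp_stronglyMeasurable_mul_of_bound hm hu.stronglyMeasurable hv C
    (Eventually.of_forall hC), h] with ω h1 h2
  rw [show (fun ω => u ω * v ω) = u * v from rfl, h1, Pi.mul_apply, h2]
  simp

end IsBoundedMeasurable

/-- An adapted bounded process with conditionally centred increments is a martingale. -/
theorem martingale_of_condExp_increment_eq_zero {Ω : Type*} {m : MeasurableSpace Ω}
    {μ : Measure Ω} [IsFiniteMeasure μ] {𝓕 : Filtration ℝ≥0 m} {N : ℝ≥0 → Ω → ℝ}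
    (hN : ∀ t, IsBoundedMeasurable (𝓕 t) (N t))
    (h : ∀ s t, μ[fun ω => N (s + t) ω - N s ω | 𝓕 s] =ᵐ[μ] 0) : Martingale N 𝓕 μ := by
  have hint : ∀ t, Integrable (N t) μ := fun t => ((hN t).mono (𝓕.le t)).integrable μ
  refine ⟨fun t => (hN t).1.stronglyMeasurable, fun s t hst => ?_⟩
  obtain ⟨r, rfl⟩ := exists_add_of_le hst
  filter_upwards [h s r, condExp_sub (hint (s + r)) (hint s) (𝓕 s)] with ω h1 h2
  rw [condExp_of_stronglyMeasurable (𝓕.le s) (hN s).1.stronglyMeasurable (hint s)] at h2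
  exact sub_eq_zero.1 (h2.symm.trans h1)

/-- A martingale and its past value have the same integral against bounded variables
measurable with respect to the past. -/
theorem MeasureTheory.Martingale.integral_mul_eq {Ω : Type*} {m : MeasurableSpace Ω}
    {μ : Measure Ω} [IsFiniteMeasure μ] {𝓕 : Filtration ℝ≥0 m} {N : ℝ≥0 → Ω → ℝ}
    (hN : Martingale N 𝓕 μ) {s t : ℝ≥0} (hst : s ≤ t) {v : Ω → ℝ}
    (hv : IsBoundedMeasurable (𝓕 s) v) :
    ∫ ω, v ω * N t ω ∂μ = ∫ ω, v ω * N s ω ∂μ := by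
  obtain ⟨hv, C, hC⟩ := hv
  rw [← integral_condExp (𝓕.le s)]
  refine integral_congr_ae ?_
  filter_upwards [condExp_stronglyMeasurable_mul_of_bound (𝓕.le s) hv.stronglyMeasurable
    (hN.integrable t) C (Eventually.of_forall hC), hN.2 s t hst] with ω h1 h2
  rw [show (fun ω => v ω * N t ω) = v * N t from rfl, h1, Pi.mul_apply, h2]

/-! ### The Dynkin martingale and its quadratic variation. -/

namespace FellerProcess

variable {S : Type*} [TopologicalSpace S] [MeasurableSpace S]

theorem condExp_shift_eq_zero (X : FellerProcess S) {Y : CadlagPath S → ℝ}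
    (hY : IsBoundedMeasurable inferInstance Y) (h0 : ∀ y, ∫ ω, Y ω ∂(X.law y) = 0) (x : S)
    (s : ℝ≥0) :
    (X.law x)[fun ω => Y (CadlagPath.shift s ω) | X.filtration s] =ᵐ[X.law x] 0 := by
  filter_upwards [X.markov x s Y hY.1 hY.2] with ω h
  rw [h, h0, Pi.zero_apply]

theorem dynkin_add_shift (X : FellerProcess S) (f : C₀(S, ℝ)) (s t : ℝ≥0) (ω : CadlagPath S) :
    X.dynkin f (s + t) ω = X.dynkin f s ω + X.dynkin f t (CadlagPath.shift s ω) := by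
  simp only [dynkin, additiveFunctional_add_shift, CadlagPath.shift, add_zero]
  ring

theorem abs_dynkin_le (X : FellerProcess S) (f : C₀(S, ℝ)) (t : ℝ≥0) (ω : CadlagPath S) :
    |X.dynkin f t ω| ≤ ‖f‖ + ‖f‖ + ‖X.generator f‖ * t :=
  (abs_sub _ _).trans (add_le_add ((abs_sub _ _).trans
    (add_le_add (f.abs_apply_le_norm _) (f.abs_apply_le_norm _))) (abs_additiveFunctional_le _ _ _))

theorem isCadlag_dynkin (X : FellerProcess S) (f : C₀(S, ℝ)) (ω : CadlagPath S) :
    IsCadlag (fun t => X.dynkin f t ω) :=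
  ((isCadlag_comp f ω).sub continuous_const.isCadlag).sub
    (continuous_additiveFunctional _ ω).isCadlag

theorem additiveFunctional_carreDuChamp (X : FellerProcess S) (f : C₀(S, ℝ)) (t : ℝ≥0)
    (ω : CadlagPath S) :
    additiveFunctional (X.carreDuChamp f) t ω = additiveFunctional (X.generator (f * f)) t ω -
      2 * additiveFunctional (f * X.generator f) t ω := by
  rw [carreDuChamp, additiveFunctional_sub, additiveFunctional_smul]

/-- Expand `M_s`; the term where `g(X_s)` meets its own primitive integrates to half a square. -/
theorem integral_dynkin_mul_path (X : FellerProcess S) (f : C₀(S, ℝ)) (t : ℝ≥0)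
    (ω : CadlagPath S) :
    ∫ s in (0 : ℝ)..(t : ℝ), X.generator f (ω.1 s.toNNReal) * X.dynkin f s.toNNReal ω =
      additiveFunctional (f * X.generator f) t ω
        - f (ω.1 0) * additiveFunctional (X.generator f) t ω
        - additiveFunctional (X.generator f) t ω * additiveFunctional (X.generator f) t ω / 2 := by
  set g := X.generator f
  have hI : IntervalIntegrable
      (fun s : ℝ => additiveFunctional g s.toNNReal ω * g (ω.1 s.toNNReal)) volume 0 t :=
    (intervalIntegrable_path g ω _ _).continuousOn_mul
      ((continuous_additiveFunctional g ω).comp continuous_real_toNNReal).continuousOn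
  have hc : IntervalIntegrable (fun s : ℝ => f (ω.1 0) * g (ω.1 s.toNNReal)) volume 0 t :=
    (intervalIntegrable_path g ω _ _).const_mul _
  rw [← sq, ← integral_additiveFunctional_mul g t ω, additiveFunctional, additiveFunctional,
    ← intervalIntegral.integral_const_mul, ← intervalIntegral.integral_sub
      (intervalIntegrable_path (f * g) ω _ _) hc, ← intervalIntegral.integral_sub
      ((intervalIntegrable_path (f * g) ω _ _).sub hc) hI]
  congr 1
  ext s
  simp only [dynkin, ZeroAtInftyContinuousMap.mul_apply]
  ring

variable [OpensMeasurableSpace S]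

theorem isBoundedMeasurable_eval (X : FellerProcess S) (g : C₀(S, ℝ)) (t : ℝ≥0) :
    IsBoundedMeasurable (X.filtration t) (fun ω : CadlagPath S => g (ω.1 t)) :=
  ⟨X.measurable_eval_filtration g t, ‖g‖, fun _ => g.abs_apply_le_norm _⟩

theorem isBoundedMeasurable_additiveFunctional (X : FellerProcess S) (g : C₀(S, ℝ)) (t : ℝ≥0) :
    IsBoundedMeasurable (X.filtration t) (additiveFunctional g t) :=
  ⟨X.measurable_additiveFunctional_filtration g t, ‖g‖ * t,
    fun _ => abs_additiveFunctional_le _ _ _⟩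

theorem isBoundedMeasurable_dynkin (X : FellerProcess S) (f : C₀(S, ℝ)) (t : ℝ≥0) :
    IsBoundedMeasurable (X.filtration t) (X.dynkin f t) :=
  ((X.isBoundedMeasurable_eval f t).sub ((X.isBoundedMeasurable_eval f 0).mono
    (X.filtration.mono zero_le))).sub (X.isBoundedMeasurable_additiveFunctional _ t)

theorem integral_dynkin_eq_zero (X : FellerProcess S) {f : C₀(S, ℝ)} (hf : f ∈ X.domain) (t : ℝ≥0)
    (x : S) : ∫ ω, X.dynkin f t ω ∂(X.law x) = 0 := by
  have h1 := X.integrable_eval f t x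
  have h2 := X.integrable_eval f 0 x
  have h12 : Integrable (fun ω : CadlagPath S => f (ω.1 t) - f (ω.1 0)) (X.law x) := h1.sub h2
  simp only [dynkin]
  rw [integral_sub h12 (X.integrable_additiveFunctional _ t x), integral_sub h1 h2,
    X.integral_additiveFunctional_generator hf, X.integral_eval_zero, semigroup_apply, sub_self]

theorem martingale_dynkin (X : FellerProcess S) {f : C₀(S, ℝ)} (hf : f ∈ X.domain) (x : S) :
    Martingale (X.dynkin f) X.filtration (X.law x) := by
  refine martingale_of_condExp_increment_eq_zero (X.isBoundedMeasurable_dynkin f) fun s t => ?_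
  have h : (fun ω => X.dynkin f (s + t) ω - X.dynkin f s ω) =
      fun ω => X.dynkin f t (CadlagPath.shift s ω) := by
    ext ω
    rw [dynkin_add_shift, add_sub_cancel_left]
  rw [h]
  exact X.condExp_shift_eq_zero ((X.isBoundedMeasurable_dynkin f t).mono (X.filtration.le t))
    (X.integral_dynkin_eq_zero hf t) x s

theorem measurable_uncurry_dynkin (X : FellerProcess S) (f : C₀(S, ℝ)) :
    Measurable (Function.uncurry fun (s : ℝ) (ω : CadlagPath S) => X.dynkin f s.toNNReal ω) := by
  refine measurable_uncurry_of_continuousWithinAt_Ici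
    (fun s => ((X.isBoundedMeasurable_dynkin f _).mono (X.filtration.le _)).1) fun ω s => ?_
  exact ((continuousWithinAt_path f ω s).sub continuousWithinAt_const).sub
    ((continuous_additiveFunctional _ ω).comp continuous_real_toNNReal).continuousWithinAt

/-- Move `M_t` inside the time integral and exchange integrals; at each `s ≤ t` the martingale
property replaces `M_t` by `M_s`. -/
theorem integral_dynkin_mul_additiveFunctional (X : FellerProcess S) {f : C₀(S, ℝ)}
    (hf : f ∈ X.domain) (t : ℝ≥0) (x : S) :
    ∫ ω, additiveFunctional (X.generator f) t ω * X.dynkin f t ω ∂(X.law x) =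
      ∫ ω, (∫ s in (0 : ℝ)..(t : ℝ), X.generator f (ω.1 s.toNNReal) * X.dynkin f s.toNNReal ω)
        ∂(X.law x) := by
  set g := X.generator f
  obtain ⟨hm, C, hC⟩ := (X.isBoundedMeasurable_dynkin f t).mono (X.filtration.le t)
  simp only [additiveFunctional, ← intervalIntegral.integral_mul_const]
  have h1 : Measurable (Function.uncurry fun (s : ℝ) (ω : CadlagPath S) =>
      g (ω.1 s.toNNReal) * X.dynkin f t ω) :=
    (measurable_uncurry_path g).mul (hm.comp measurable_snd)
  have h2 : Measurable (Function.uncurry fun (s : ℝ) (ω : CadlagPath S) =>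
      g (ω.1 s.toNNReal) * X.dynkin f s.toNNReal ω) :=
    (measurable_uncurry_path g).mul (X.measurable_uncurry_dynkin f)
  have hle : ∀ s ∈ Set.uIoc (0 : ℝ) t, s.toNNReal ≤ t := by
    intro s hs
    rw [Set.uIoc_of_le t.coe_nonneg] at hs
    exact Real.toNNReal_le_iff_le_coe.2 hs.2
  have hb : ∀ (s r : ℝ≥0), r ≤ t → ∀ ω : CadlagPath S, |g (ω.1 s) * X.dynkin f r ω| ≤
      ‖g‖ * (‖f‖ + ‖f‖ + ‖g‖ * t) := by
    intro s r hr ω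
    rw [abs_mul]
    refine mul_le_mul (g.abs_apply_le_norm _) ((X.abs_dynkin_le f r ω).trans ?_) (abs_nonneg _)
      (norm_nonneg _)
    gcongr
  rw [integral_intervalIntegral_swap_of_bound h1 fun s _ => hb _ t le_rfl,
    integral_intervalIntegral_swap_of_bound h2 fun s hs => hb _ _ (hle s hs)]
  refine intervalIntegral.integral_congr_ae (Eventually.of_forall fun s hs => ?_)
  exact (X.martingale_dynkin hf x).integral_mul_eq (hle s hs) (X.isBoundedMeasurable_eval g _)

theorem integral_dynkin_sq_sub_eq_zero (X : FellerProcess S) {f : C₀(S, ℝ)} (hf : f ∈ X.domain)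
    (hff : f * f ∈ X.domain) (t : ℝ≥0) (x : S) :
    ∫ ω, (X.dynkin f t ω ^ 2 - additiveFunctional (X.carreDuChamp f) t ω) ∂(X.law x) = 0 := by
  set g := X.generator f with hg
  have hM := (X.isBoundedMeasurable_dynkin f t).mono (X.filtration.le t)
  have hMM := (X.isBoundedMeasurable_dynkin (f * f) t).mono (X.filtration.le t)
  have hF0 := (X.isBoundedMeasurable_eval f 0).mono (X.filtration.le 0)
  have hI := (X.isBoundedMeasurable_additiveFunctional g t).mono (X.filtration.le t)
  have hfg := (X.isBoundedMeasurable_additiveFunctional (f * g) t).mono (X.filtration.le t)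
  -- The value of `∫₀ᵗ g(X_s) M_s ds` computed by `integral_dynkin_mul_path`.
  let J : CadlagPath S → ℝ := fun ω => additiveFunctional (f * g) t ω
    - f (ω.1 0) * additiveFunctional g t ω
    - additiveFunctional g t ω * additiveFunctional g t ω * (1 / 2)
  have hJ : IsBoundedMeasurable inferInstance J :=
    (hfg.sub (hF0.mul hI)).sub ((hI.mul hI).mul (.const _))
  have hIM : ∫ ω, additiveFunctional g t ω * X.dynkin f t ω ∂(X.law x) = ∫ ω, J ω ∂(X.law x) := by
    rw [X.integral_dynkin_mul_additiveFunctional hf]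
    simp only [integral_dynkin_mul_path, J, hg]
    ring_nf
  -- `f(X_0)` is `𝓕_0`-measurable and `M_0 = 0`.
  have hFM : ∫ ω, f (ω.1 0) * X.dynkin f t ω ∂(X.law x) = 0 := by
    rw [(X.martingale_dynkin hf x).integral_mul_eq zero_le (X.isBoundedMeasurable_eval f 0)]
    simp [dynkin, additiveFunctional_zero]
  have hpath : ∀ ω, X.dynkin f t ω ^ 2 - additiveFunctional (X.carreDuChamp f) t ω =
      X.dynkin (f * f) t ω - 2 * (f (ω.1 0) * X.dynkin f t ω) -
        2 * (additiveFunctional g t ω * X.dynkin f t ω - J ω) := by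
    intro ω
    rw [additiveFunctional_carreDuChamp]
    simp only [dynkin, ZeroAtInftyContinuousMap.mul_apply, J, hg]
    ring
  have i1 := hMM.integrable (X.law x)
  have i2 := ((hF0.mul hM).integrable (X.law x)).const_mul 2
  have i3 := (hI.mul hM).integrable (X.law x)
  have i4 := hJ.integrable (X.law x)
  have i12 : Integrable (fun ω => X.dynkin (f * f) t ω - 2 * (f (ω.1 0) * X.dynkin f t ω))
    (X.law x) := i1.sub i2
  have i34 : Integrable (fun ω => additiveFunctional g t ω * X.dynkin f t ω - J ω) (X.law x) :=
    i3.sub i4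
  simp only [hpath]
  rw [integral_sub i12 (i34.const_mul 2), integral_sub i1 i2, integral_const_mul,
    integral_const_mul, integral_sub i3 i4, hIM, hFM, X.integral_dynkin_eq_zero hff]
  simp

theorem martingale_dynkin_sq_sub (X : FellerProcess S) {f : C₀(S, ℝ)} (hf : f ∈ X.domain)
    (hff : f * f ∈ X.domain) (x : S) :
    Martingale (fun t ω => X.dynkin f t ω ^ 2 - additiveFunctional (X.carreDuChamp f) t ω)
      X.filtration (X.law x) := by
  have hN : ∀ t, IsBoundedMeasurable (X.filtration t)
      (fun ω => X.dynkin f t ω ^ 2 - additiveFunctional (X.carreDuChamp f) t ω) := by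
    intro t
    simp only [sq]
    exact ((X.isBoundedMeasurable_dynkin f t).mul (X.isBoundedMeasurable_dynkin f t)).sub
      (X.isBoundedMeasurable_additiveFunctional _ t)
  refine martingale_of_condExp_increment_eq_zero hN fun s t => ?_
  let Y : CadlagPath S → ℝ := fun ω =>
    X.dynkin f t ω ^ 2 - additiveFunctional (X.carreDuChamp f) t ω
  have hY : IsBoundedMeasurable inferInstance Y := (hN t).mono (X.filtration.le t)
  have hD := (X.isBoundedMeasurable_dynkin f t).mono (X.filtration.le t)
  have hDs : Integrable (fun ω => X.dynkin f t (CadlagPath.shift s ω)) (X.law x) :=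
    IsBoundedMeasurable.integrable
      ⟨hD.1.comp (measurable_shift s), hD.2.imp fun _ h _ => h _⟩ _
  have hYs : Integrable (fun ω => Y (CadlagPath.shift s ω)) (X.law x) :=
    IsBoundedMeasurable.integrable
      ⟨hY.1.comp (measurable_shift s), hY.2.imp fun _ h _ => h _⟩ _
  have h : (fun ω => X.dynkin f (s + t) ω ^ 2 - additiveFunctional (X.carreDuChamp f) (s + t) ω -
      (X.dynkin f s ω ^ 2 - additiveFunctional (X.carreDuChamp f) s ω)) =
      -- The cross term comes from squaring `M_s + M_t ∘ θ_s`; its factor `2 M_s` is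
      -- `𝓕_s`-measurable and is pulled out.
      (fun ω => Y (CadlagPath.shift s ω)) +
        fun ω => 2 * X.dynkin f s ω * X.dynkin f t (CadlagPath.shift s ω) := by
    ext ω
    simp only [Y, Pi.add_apply, dynkin_add_shift, additiveFunctional_add_shift]
    ring
  have hMs := (IsBoundedMeasurable.const 2).mul (X.isBoundedMeasurable_dynkin f s)
  have hprod : Integrable
      (fun ω => 2 * X.dynkin f s ω * X.dynkin f t (CadlagPath.shift s ω)) (X.law x) :=
    ((hMs.mono (X.filtration.le s)).mul
      ⟨hD.1.comp (measurable_shift s), hD.2.imp fun _ h _ => h _⟩).integrable _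
  rw [h]
  filter_upwards [condExp_add hYs hprod (X.filtration s),
    X.condExp_shift_eq_zero hY (X.integral_dynkin_sq_sub_eq_zero hf hff t) x s,
    hMs.condExp_mul_eq_zero (X.filtration.le s) hDs
      (X.condExp_shift_eq_zero hD (X.integral_dynkin_eq_zero hf t) x s)] with ω h1 h2 h3
  rw [h1, Pi.add_apply, h2, h3]
  simp

/-- `Γ_f(x)` is the limit of `t⁻¹ E_x[(f(X_t) - f(x))²]`, as expanding the square shows. -/
theorem carreDuChamp_nonneg (X : FellerProcess S) {f : C₀(S, ℝ)} (hf : f ∈ X.domain)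
    (hff : f * f ∈ X.domain) (x : S) : 0 ≤ X.carreDuChamp f x := by
  have hlim : Tendsto (fun t => X.diffQuotient (f * f) t - (2 : ℝ) • (f * X.diffQuotient f t))
      (𝓝[>] 0) (𝓝 (X.carreDuChamp f)) :=
    (X.tendsto_diffQuotient hff).sub (((X.tendsto_diffQuotient hf).const_mul f).const_smul 2)
  have hx := tendsto_iff_norm_sub_tendsto_zero.1 hlim
  have hlim' : Tendsto (fun t => (X.diffQuotient (f * f) t - (2 : ℝ) • (f * X.diffQuotient f t)) x)
      (𝓝[>] 0) (𝓝 (X.carreDuChamp f x)) :=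
    tendsto_iff_dist_tendsto_zero.2 (squeeze_zero (fun _ => dist_nonneg)
      (fun t => ZeroAtInftyContinuousMap.abs_apply_le_norm (X.diffQuotient (f * f) t -
        (2 : ℝ) • (f * X.diffQuotient f t) - X.carreDuChamp f) x) hx)
  -- The inequality holds for every `t`, including `t = 0`, where the inverse is `0` by convention.
  refine ge_of_tendsto hlim' (Eventually.of_forall fun t => ?_)
  have hE : 0 ≤ ∫ ω, (f (ω.1 t) - f x) * (f (ω.1 t) - f x) ∂(X.law x) :=
    integral_nonneg fun ω => mul_self_nonneg _
  have h1 : ∀ ω : CadlagPath S, (f (ω.1 t) - f x) * (f (ω.1 t) - f x) =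
      (f * f) (ω.1 t) - 2 * f x * f (ω.1 t) + f x * f x := by
    intro ω
    simp only [ZeroAtInftyContinuousMap.mul_apply]
    ring
  have i1 := X.integrable_eval (f * f) t x
  have i2 := (X.integrable_eval f t x).const_mul (2 * f x)
  have i12 : Integrable (fun ω : CadlagPath S => (f * f) (ω.1 t) - 2 * f x * f (ω.1 t)) (X.law x) :=
    i1.sub i2
  simp only [h1] at hE
  rw [integral_add i12 (integrable_const _), integral_sub i1 i2, integral_const_mul,
    integral_const, ← semigroup_apply, ← semigroup_apply] at hE
  have : (X.diffQuotient (f * f) t - (2 : ℝ) • (f * X.diffQuotient f t)) x = (t : ℝ)⁻¹ *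
      (X.semigroup t (f * f) x - 2 * f x * X.semigroup t f x + f x * f x) := by
    simp only [diffQuotient, ZeroAtInftyContinuousMap.sub_apply, ZeroAtInftyContinuousMap.smul_apply,
      ZeroAtInftyContinuousMap.mul_apply, smul_eq_mul]
    ring
  rw [this]
  refine mul_nonneg (by positivity) (by simpa using hE)

end FellerProcess

theorem mainTheorem7 {S : Type*} [TopologicalSpace S] [PolishSpace S] [MeasurableSpace S]
    [BorelSpace S] (X : FellerProcess S) (f : C₀(S, ℝ)) (hf : f ∈ X.domain) :
    (∀ x : S, Martingale (X.dynkin f) X.filtration (X.law x)) ∧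
      (f * f ∈ X.domain → ∀ x : S,
        IsPredictableQuadraticVariation (X.dynkin f)
          (FellerProcess.additiveFunctional (X.carreDuChamp f)) X.filtration (X.law x)) := by
  refine ⟨X.martingale_dynkin hf, fun hff x => ?_⟩
  exact
    { martingale := X.martingale_dynkin hf x
      memLp_two := fun t => ((X.isBoundedMeasurable_dynkin f t).mono (X.filtration.le t)).memLp 2 _
      cadlag := Eventually.of_forall (X.isCadlag_dynkin f)
      predictable := isStronglyPredictable_of_continuous
        (X.measurable_additiveFunctional_filtration _)
        (FellerProcess.continuous_additiveFunctional _)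
      zero := Eventually.of_forall (FellerProcess.additiveFunctional_zero _)
      monotone := Eventually.of_forall
        (FellerProcess.additiveFunctional_mono_of_nonneg (X.carreDuChamp_nonneg hf hff))
      cadlag_variation := Eventually.of_forall fun ω =>
        (FellerProcess.continuous_additiveFunctional _ ω).isCadlag
      martingale_sq_sub := X.martingale_dynkin_sq_sub hf hff x }
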